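/- Let $T$ be a complete first-order theory with infinite models in a language $L$, and write $|T|=|L|+\aleph_0$ (similarly for other theories). Suppose that $T$ is stable, i.e. there are no $L$-formula $\varphi(x,y)$ ($x,y$ finite tuples of variables), model $M\models T$ and tuples $(a_i)_{i<\omega}$, $(b_j)_{j<\omega}$ in $M$ such that $M\models\varphi(a_i,b_j)\iff i<j$ for all $i,j<\omega$. Then for every cardinal $\kappa\ge|T|$, $T$ has local PC-exact saturation at $\kappa$; that is, for every language $L_1\supseteq L$ and every consistent $L_1$-theory $T_1\supseteq T$ with $|T_1|=|T|$, there is a model $M\models T$ which has an expansion to a model of $T_1$ and which is $\kappa$-locally saturated but not $\kappa^+$-locally saturated. Here, for a set $\Delta$ of $L$-formulas, a finite tuple of variables $x$, and $A\subseteq M$, let $L_{x,\Delta}(A)$ be the set of all formulas obtained from a formula in the Boolean algebra generated by $\Delta$ by substituting variables from $x$ and elements of $A$ for its free variables. A $\Delta$-type over $A$ in the variables $x$ is a maximal consistent (equivalently, maximal finitely satisfiable in $M$) subset of $L_{x,\Delta}(A)$, and a local type over $A$ is a $\Delta$-type over $A$ for some finite $\Delta$. The structure $M$ is $\lambda$-locally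 saturated if every local type in finitely many variables over a set $A\subseteq M$ with $|A|<\lambda$ is realized in $M$. -/

import Mathlib

universe u v u₁ v₁ w

namespace FirstOrder

namespace Language

/-- The Boolean algebra of formulas generated by `Δ`. The connectives `∼`, `⊓`, `⊔`, `⊤`, `iff` are
all abbreviations in terms of `⊥` and `imp`. The formulas have their free variables among
`v₀, v₁, …`. -/
inductive BooleanSpan {L : Language.{u, v}} (Δ : Set (L.Formula ℕ)) : L.Formula ℕ → Prop
  | of (φ : L.Formula ℕ) : φ ∈ Δ → BooleanSpan Δ φ
  | bot : BooleanSpan Δ ⊥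
  | imp (φ ψ : L.Formula ℕ) : BooleanSpan Δ φ → BooleanSpan Δ ψ → BooleanSpan Δ (φ.imp ψ)

section LocalTypes

variable {L : Language.{u, v}} {M : Type w} [L.Structure M] {A : Set M} {n : ℕ}

/-- The set `L_{x,Δ}(A)` for `x = (x₀, …, xₙ₋₁)`: all formulas obtained from a formula in the Boolean
algebra generated by `Δ` by substituting variables from `x` and parameters from `A` for its
variables, under all partitions. -/
def deltaFormulas (Δ : Set (L.Formula ℕ)) (A : Set M) (n : ℕ) : Set (L.Formula (Fin n ⊕ A)) :=
  {χ | ∃ φ : L.Formula ℕ, BooleanSpan Δ φ ∧ ∃ σ : ℕ → Fin n ⊕ A, χ = φ.relabel σ}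

/-- The tuple `b` from `M` satisfies all formulas in `p`, where elements of `A` are interpreted as
themselves. -/
def RealizesSet (p : Set (L.Formula (Fin n ⊕ A))) (b : Fin n → M) : Prop :=
  ∀ φ ∈ p, φ.Realize (Sum.elim b (fun a : A => (a : M)))

/-- Consistency of a set of formulas in `x` over `A ⊆ M` (with the elementary diagram of `M`):
every finite subset is satisfied by a tuple in `M`. -/
def ConsistentSet (p : Set (L.Formula (Fin n ⊕ A))) : Prop :=
  ∀ q : Finset (L.Formula (Fin n ⊕ A)), (q : Set (L.Formula (Fin n ⊕ A))) ⊆ p →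
    ∃ b : Fin n → M, RealizesSet (q : Set (L.Formula (Fin n ⊕ A))) b

/-- `p` is a `Δ`-type over `A` in the variables `x₀, …, xₙ₋₁`: a maximal consistent set of formulas
from `L_{x,Δ}(A)`. -/
def IsDeltaType (Δ : Set (L.Formula ℕ)) (p : Set (L.Formula (Fin n ⊕ A))) : Prop :=
  Maximal (fun q : Set (L.Formula (Fin n ⊕ A)) => q ⊆ deltaFormulas Δ A n ∧ ConsistentSet q) p

/-- A local type is a `Δ`-type for some finite set of formulas `Δ`. -/
def IsLocalType (p : Set (L.Formula (Fin n ⊕ A))) : Prop :=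
  ∃ Δ : Set (L.Formula ℕ), Δ.Finite ∧ IsDeltaType Δ p

end LocalTypes

/-- `M` is `κ`-locally saturated: every local type in finitely many variables over a set of fewer
than `κ` elements is realized. -/
def IsLocallySaturated (L : Language.{u, v}) (M : Type w) [L.Structure M] (κ : Cardinal.{w}) :
    Prop :=
  ∀ A : Set M, Cardinal.mk A < κ → ∀ (n : ℕ) (p : Set (L.Formula (Fin n ⊕ A))),
    IsLocalType p → ∃ b : Fin n → M, RealizesSet p b

namespace Theory

/-- The cardinality `|T|` of a theory, in the usual convention: the number of symbols of its
language plus `ℵ₀`. -/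
def size {L : Language.{u, v}} (_T : L.Theory) : Cardinal.{max u v} :=
  L.card + Cardinal.aleph0

/-- `T` is stable: no formula `φ(x, y)`, with `x`, `y` finite tuples of variables, has the order
property in a model of `T`. -/
def IsStable {L : Language.{u, v}} (T : L.Theory) : Prop :=
  ∀ (M : T.ModelType.{u, v, max u v}) (m n : ℕ) (φ : L.Formula (Fin m ⊕ Fin n)),
    ¬ ∃ (a : ℕ → Fin m → M) (b : ℕ → Fin n → M),
      ∀ i j : ℕ, φ.Realize (Sum.elim (a i) (b j)) ↔ i < j

/-- The model `M` of `T` belongs to `PC(T₁, T)`: it has an expansion to a model of `T₁`, where the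
language of `T₁` extends that of `T` along `ϕ`. -/
def InPC {L : Language.{u, v}} {L₁ : Language.{u₁, v₁}} (ϕ : L →ᴸ L₁) (T : L.Theory)
    (T₁ : L₁.Theory) (M : T.ModelType.{u, v, w}) : Prop :=
  ∃ _ : L₁.Structure M, ϕ.IsExpansionOn M ∧ T₁.Model M

/-- The class `PC(T₁, T)` has local exact saturation at `κ`. -/
def PCHasLocalExactSaturation {L : Language.{u, v}} {L₁ : Language.{u₁, v₁}} (ϕ : L →ᴸ L₁)
    (T : L.Theory) (T₁ : L₁.Theory) (κ : Cardinal.{w}) : Prop :=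
  ∃ M : T.ModelType.{u, v, w}, InPC ϕ T T₁ M ∧
    L.IsLocallySaturated M κ ∧ ¬ L.IsLocallySaturated M (Order.succ κ)

/-- `T` has local PC-exact saturation at `κ`: for every (consistent) theory `T₁ ⊇ T` with
`|T₁| = |T|`, in a language `L₁ ⊇ L`, the class `PC(T₁, T)` has local exact saturation at `κ`. -/
def HasLocalPCExactSaturation {L : Language.{u, v}} (T : L.Theory) (κ : Cardinal.{w}) : Prop :=
  ∀ (L₁ : Language.{u₁, v₁}) (ϕ : L →ᴸ L₁), ϕ.Injective →
    ∀ T₁ : L₁.Theory, T₁.IsSatisfiable → ϕ.onTheory T ⊆ T₁ →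
      Cardinal.lift.{max u v} T₁.size = Cardinal.lift.{max u₁ v₁} T.size →
        PCHasLocalExactSaturation ϕ T T₁ κ

end Theory

end Language

end FirstOrder

universe w' x y

open Cardinal CategoryTheory

/-! A model of `T₁` of size exactly `κ` is not `κ⁺`-locally saturated, since it omits the type of an
element different from all of its own. It remains to find such a model that realizes every local
type over fewer than `κ` parameters, although the parameter sets may number more than `κ`.

Stability replaces local types by first-order patterns with finitely many parameters. A local type
is carried by an ultrafilter on `n`-tuples of the model. Since orders have bounded length, some
sequence of tuples approximates it so well that each parameter has fewer than `K` exceptions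
(`Ultrafilter.exists_seq_few_exceptions`). The limit is then a majority vote among `2 * K` terms, so
"any `K` members include one agreeing with the limit" is a first-order condition on `K` members over
those terms.

There are at most `κ` such patterns. An elementary chain of length `ω` gives a model of `T₁` of size
`κ` in which each pattern with arbitrarily long finite families has one of size `κ`
(`Theory.exists_model_hasHomogeneousFamilies`). In that family each parameter tuple has finitely
many exceptions, so fewer than `κ` tuples leave a member with none, and it realizes the type. -/

/-! ### Approximating an ultrafilter by a sequence. -/

theorem Ultrafilter.exists_seq_one_sided {ι X Y : Type*} [Finite ι] (U : Ultrafilter X)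
    (Q : ι → X → Y → Prop) (K : ℕ)
    (hQ : ∀ i, ¬ ∃ (a : Fin K → X) (b : Fin K → Y), ∀ s t, Q i (a s) (b t) ↔ s < t) :
    ∃ a : ℕ → X, ∀ i y, (∀ᶠ x in U, ¬ Q i x y) → ∀ e : Fin K → ℕ, StrictMono e →
      ∃ s, ¬ Q i (a (e s)) y := by
  classical
  -- The witness for `F` is a parameter rejected by the ultrafilter but accepted by all of `F`, if
  -- there is one. Each new term is chosen to reject the witnesses of all sets of earlier terms.
  have hw : ∀ (i : ι) (F : Finset X), ∃ y : Option Y,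
      (∀ y' ∈ y, ∀ᶠ x in U, ¬ Q i x y') ∧
      ((∃ y, (∀ᶠ x in U, ¬ Q i x y) ∧ ∀ x ∈ F, Q i x y) → ∃ y' ∈ y, ∀ x ∈ F, Q i x y') := by
    intro i F
    by_cases h : ∃ y, (∀ᶠ x in U, ¬ Q i x y) ∧ ∀ x ∈ F, Q i x y
    · obtain ⟨y, hy, hy'⟩ := h
      exact ⟨some y, by simpa using hy, fun _ => ⟨y, rfl, hy'⟩⟩
    · exact ⟨none, by simp, fun h' => absurd h' h⟩
  choose wit hwit hwit' using hw
  have hnext : ∀ F : Finset X, ∃ x, ∀ i, ∀ G ∈ F.powerset, ∀ y ∈ wit i G, ¬ Q i x y := by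
    intro F
    have : ∀ᶠ x in (U : Filter X), ∀ i, ∀ G ∈ F.powerset, ∀ y ∈ wit i G, ¬ Q i x y := by
      rw [Filter.eventually_all]
      intro i
      rw [Finset.eventually_all]
      intro G _
      cases h : wit i G with
      | none => simp
      | some y => simpa using hwit i G y (by simp [h])
    exact this.exists
  choose next hnext using hnext
  let F : ℕ → Finset X := fun j => Nat.rec ∅ (fun _ G => insert (next G) G) j
  have hF : ∀ j, F (j + 1) = insert (next (F j)) (F j) := fun j => rfl
  have hmono : Monotone F := monotone_nat_of_le_succ fun j => by
    rw [hF]; exact Finset.subset_insert _ _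
  have hmem : ∀ {k j}, k < j → next (F k) ∈ F j := fun {k j} h =>
    hmono (Nat.succ_le_of_lt h) (by rw [hF]; exact Finset.mem_insert_self _ _)
  refine ⟨fun j => next (F j), fun i y hy e he => ?_⟩
  by_contra! hcon
  have hb : ∀ t : Fin K, ∃ b ∈ wit i ((Finset.univ.filter (· < t)).image fun s => next (F (e s))),
      ∀ x ∈ (Finset.univ.filter (· < t)).image fun s => next (F (e s)), Q i x b := by
    intro t
    refine hwit' i _ ⟨y, hy, fun x hx => ?_⟩
    obtain ⟨s, -, rfl⟩ := Finset.mem_image.1 hx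
    exact hcon s
  choose b hbw hbQ using hb
  -- A bad `y` yields an order of length `K`: `b t` is accepted by the terms before position `t`,
  -- and the terms from `t` on were chosen against it.
  refine hQ i ⟨fun s => next (F (e s)), b, fun s t => ⟨fun h => ?_, fun h => ?_⟩⟩
  · by_contra hst
    refine hnext (F (e s)) i _ ?_ (b t) (hbw t) h
    rw [Finset.mem_powerset]
    intro x hx
    obtain ⟨r, hr, rfl⟩ := Finset.mem_image.1 hx
    exact hmem (he ((Finset.mem_filter.1 hr).2.trans_le (not_lt.1 hst)))
  · exact hbQ t _ (Finset.mem_image.2 ⟨s, by simpa using h, rfl⟩)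

/-- If finitely many relations have no long orders, then a type given by an ultrafilter is
approximated by a sequence: each parameter `y` has fewer than `K` exceptions. -/
theorem Ultrafilter.exists_seq_few_exceptions {ι X Y : Type*} [Finite ι] (U : Ultrafilter X)
    (R : ι → X → Y → Prop) (K : ℕ)
    (h : ∀ i, ¬ ∃ (a : Fin K → X) (b : Fin K → Y), ∀ s t, R i (a s) (b t) ↔ s < t)
    (h' : ∀ i, ¬ ∃ (a : Fin K → X) (b : Fin K → Y), ∀ s t, ¬ R i (a s) (b t) ↔ s < t) :
    ∃ a : ℕ → X, ∀ i y (e : Fin K ↪ ℕ), ∃ s, R i (a (e s)) y ↔ ∀ᶠ x in U, R i x y := by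
  classical
  obtain ⟨a, ha⟩ := U.exists_seq_one_sided
    (fun (q : ι × Bool) x y => if q.2 then R q.1 x y else ¬ R q.1 x y) K (by
      rintro ⟨i, _ | _⟩
      · simpa using h' i
      · simpa using h i)
  refine ⟨a, fun i y e => ?_⟩
  let e' := (Finset.univ.map e).orderEmbOfFin (k := K) (by simp)
  have he' : ∀ s, ∃ r, e r = e' s := fun s => by
    have := Finset.orderEmbOfFin_mem (Finset.univ.map e) (k := K) (by simp) s
    obtain ⟨r, -, hr⟩ := Finset.mem_map.1 this
    exact ⟨r, hr⟩
  by_cases hD : ∀ᶠ x in U, R i x y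
  · obtain ⟨s, hs⟩ := ha (i, false) y (by simpa using hD) e' e'.strictMono
    obtain ⟨r, hr⟩ := he' s
    exact ⟨r, by rw [hr]; simpa [hD] using hs⟩
  · obtain ⟨s, hs⟩ := ha (i, true) y (by simpa using Ultrafilter.eventually_not.2 hD) e' e'.strictMono
    obtain ⟨r, hr⟩ := he' s
    exact ⟨r, by rw [hr]; simpa [hD] using hs⟩

/-- If every `K` of the values `a j` contain one agreeing with `P`, then `P` is decided by whether
some `K` among any `2 * K` of them hold. -/
theorem exists_embedding_iff_of_few_exceptions {K : ℕ} {r : Fin (2 * K) → Prop} {P : Prop}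
    (h : ∀ e : Fin K ↪ Fin (2 * K), ∃ s, r (e s) ↔ P) :
    (∃ e : Fin K ↪ Fin (2 * K), ∀ s, r (e s)) ↔ P := by
  classical
  constructor
  · rintro ⟨e, he⟩
    obtain ⟨s, hs⟩ := h e
    exact hs.1 (he s)
  · intro hP
    have key : K ≤ (Finset.univ.filter fun j => r j).card := by
      by_contra! hlt
      have : K ≤ (Finset.univ.filter fun j => ¬ r j).card := by
        have hsum : (Finset.univ.filter fun j => r j).card +
            (Finset.univ.filter fun j => ¬ r j).card = 2 * K :=
          (Finset.card_filter_add_card_filter_not _).trans (by simp)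
        omega
      obtain ⟨s, hs⟩ := h (Finset.orderEmbOfCardLe _ this).toEmbedding
      have := Finset.orderEmbOfCardLe_mem _ this s
      simp only [Finset.mem_filter] at this
      exact this.2 (hs.2 hP)
    refine ⟨(Finset.orderEmbOfCardLe _ key).toEmbedding, fun s => ?_⟩
    have := Finset.orderEmbOfCardLe_mem _ key s
    simpa using this

/-! ### Compactness, change of cardinality, and bounds on orders. -/

namespace FirstOrder

namespace Language

/-- Compactness: a family of formulas, each finite part of which is realized in a model of `T`, is
realized in a model of `T`. -/
theorem Theory.exists_model_realize {L : Language.{u, v}} (T : L.Theory) {X : Type x} {G : Type y}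
    [Nonempty G] (Γ : G → L.Formula X)
    (h : ∀ s : Finset G, ∃ (M : Theory.ModelType.{u, v, w} T) (a : X → M),
      ∀ g ∈ s, (Γ g).Realize a) :
    ∃ (N : Theory.ModelType.{u, v, max u v x} T) (a : X → N), ∀ g, (Γ g).Realize a := by
  have hsat : Theory.IsSatisfiable
      (⋃ g, ((L.lhomWithConstants X).onTheory T ∪ {Formula.equivSentence (Γ g)})) := by
    rw [Theory.isSatisfiable_iUnion_iff_isSatisfiable_iUnion_finset]
    intro s
    obtain ⟨M, a, ha⟩ := h s
    let : (constantsOn X).Structure M := constantsOn.structure a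
    have : M ⊨ (⋃ g ∈ s, ((L.lhomWithConstants X).onTheory T ∪
        {Formula.equivSentence (Γ g)}) : L[[X]].Theory) := by
      rw [Theory.model_iff]
      intro φ hφ
      simp only [Set.mem_iUnion, Set.mem_union, Set.mem_singleton_iff] at hφ
      obtain ⟨g, hg, hφ | rfl⟩ := hφ
      · have : M ⊨ (L.lhomWithConstants X).onTheory T :=
          (LHom.onTheory_model _ _).2 inferInstance
        exact this.realize_of_mem φ hφ
      · rw [Formula.realize_equivSentence]
        exact ha g hg
    exact Theory.Model.isSatisfiable M
  obtain ⟨N⟩ := hsat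
  have hN : ∀ g, N ⊨ (L.lhomWithConstants X).onTheory T ∧
      N ⊨ (Formula.equivSentence (Γ g) : L[[X]].Sentence) := by
    intro g
    refine ⟨N.is_model.mono fun φ hφ => Set.mem_iUnion.2 ⟨g, Or.inl hφ⟩,
      N.is_model.realize_of_mem _ (Set.mem_iUnion.2 ⟨g, Or.inr rfl⟩)⟩
  let := (L.lhomWithConstants X).reduct N
  have : (L.lhomWithConstants X).IsExpansionOn N := LHom.isExpansionOn_reduct _ _
  obtain ⟨g₀⟩ := ‹Nonempty G›
  have : N ⊨ T := (LHom.onTheory_model _ _).1 (hN g₀).1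
  exact ⟨Theory.ModelType.of T N, fun a => (L.con a : N), fun g =>
    (Formula.realize_equivSentence N (Γ g)).1 (hN g).2⟩

/-- Every family of elements of an infinite structure has the same complete type as a family in a
structure of a prescribed large enough cardinality. -/
theorem exists_card_eq_realize_iff {L : Language.{u, v}} {X : Type x} (N : Type w') [L.Structure N]
    [Infinite N] (a : X → N) (κ : Cardinal.{w}) (hκ : ℵ₀ ≤ κ)
    (hL : Cardinal.lift.{w} L.card ≤ Cardinal.lift.{max u v} κ)
    (hX : Cardinal.lift.{w} #X ≤ Cardinal.lift.{x} κ) :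
    ∃ (N' : Bundled.{w} L.Structure) (a' : X → N'), #N' = κ ∧
      ∀ φ : L.Formula X, φ.Realize a' ↔ φ.Realize a := by
  let : (constantsOn X).Structure N := constantsOn.structure a
  have hcard : Cardinal.lift.{w} L[[X]].card ≤ Cardinal.lift.{max (max u x) v} κ := by
    rw [card_withConstants, lift_add]
    refine Cardinal.add_le_of_le (aleph0_le_lift.2 hκ) ?_ ?_
    · have := Cardinal.lift_le.{x}.2 hL
      simpa [Cardinal.lift_lift, Cardinal.lift_umax] using this
    · have := Cardinal.lift_le.{max u v}.2 hX
      simpa [Cardinal.lift_lift] using this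
  obtain ⟨N', hN', hc⟩ := exists_elementarilyEquivalent_card_eq L[[X]] N κ hκ hcard
  let := (L.lhomWithConstants X).reduct N'
  have : (L.lhomWithConstants X).IsExpansionOn N' := LHom.isExpansionOn_reduct _ _
  refine ⟨⟨N', inferInstance⟩, fun x => (L.con x : N'), hc, fun φ => ?_⟩
  refine (Formula.realize_equivSentence N' φ).symm.trans ?_
  rw [← hN'.realize_sentence, Formula.realize_equivSentence]
  rfl

/-- In a stable theory the lengths of finite orders defined by a formula are bounded. -/
theorem Theory.IsStable.exists_order_bound {L : Language.{u, v}} {T : L.Theory} (hT : T.IsStable)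
    {m n : ℕ} (φ : L.Formula (Fin m ⊕ Fin n)) :
    ∃ K : ℕ, ∀ (M : Theory.ModelType.{u, v, w} T), ¬ ∃ (a : Fin K → Fin m → M)
      (b : Fin K → Fin n → M), ∀ s t, φ.Realize (Sum.elim (a s) (b t)) ↔ s < t := by
  classical
  by_contra! hcon
  let var : ℕ → ℕ → (Fin m ⊕ Fin n) → (ℕ × Fin m) ⊕ (ℕ × Fin n) := fun i j =>
    Sum.map (fun q => (i, q)) (fun q => (j, q))
  obtain ⟨N, a, ha⟩ := T.exists_model_realize
    (X := (ℕ × Fin m) ⊕ (ℕ × Fin n)) (G := ℕ × ℕ)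
    (fun g => if g.1 < g.2 then φ.relabel (var g.1 g.2) else (φ.relabel (var g.1 g.2)).not) (by
      intro s
      obtain ⟨K, hK⟩ : ∃ K : ℕ, ∀ g ∈ s, g.1 < K ∧ g.2 < K := by
        refine ⟨s.sup (fun g => max g.1 g.2) + 1, fun g hg => ?_⟩
        have := Finset.le_sup (f := fun g : ℕ × ℕ => max g.1 g.2) hg
        simp only [max_le_iff] at this
        omega
      -- Length `K + 1` makes the index type nonempty, as `Fin.ofNat` needs; reduction modulo `K +
      -- 1` fixes all indices occurring in `s`.
      obtain ⟨M, a, b, hab⟩ := hcon (K + 1)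
      refine ⟨M, Sum.elim (fun q => a (Fin.ofNat (K + 1) q.1) q.2)
        (fun q => b (Fin.ofNat (K + 1) q.1) q.2), fun g hg => ?_⟩
      have hreal : (φ.relabel (var g.1 g.2)).Realize
          (Sum.elim (fun q => a (Fin.ofNat (K + 1) q.1) q.2)
            (fun q => b (Fin.ofNat (K + 1) q.1) q.2)) ↔ g.1 < g.2 := by
        have h1 := (hK g hg).1
        have h2 := (hK g hg).2
        rw [Formula.realize_relabel]
        have : (Fin.ofNat (K + 1) g.1 < Fin.ofNat (K + 1) g.2) ↔ g.1 < g.2 := by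
          rw [Fin.lt_def]
          simp only [Fin.ofNat]
          rw [Nat.mod_eq_of_lt (by omega), Nat.mod_eq_of_lt (by omega)]
        rw [← this, ← hab]
        apply iff_of_eq
        congr 1
        ext q
        rcases q with q | q <;> rfl
      split_ifs with hlt
      · exact hreal.2 hlt
      · exact fun h => hlt (hreal.1 h))
  refine hT N m n φ ⟨fun i q => a (Sum.inl (i, q)), fun j q => a (Sum.inr (j, q)), fun i j => ?_⟩
  have h := ha (i, j)
  have heq : a ∘ var i j = Sum.elim (fun q => a (Sum.inl (i, q))) (fun q => a (Sum.inr (j, q))) := by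
    ext q
    rcases q with q | q <;> rfl
  by_cases hij : i < j
  · simp only [hij, if_true, Formula.realize_relabel, heq] at h
    simp [hij, h]
  · simp only [hij, if_false, Formula.realize_relabel, heq, Formula.realize_not] at h
    simp [hij, h]

/-! ### Homogeneous families and models containing large ones. -/

section Homogeneous

variable {L : Language.{u, v}} {M : Type w} [L.Structure M] {N : Type w'} [L.Structure N]
  {n p k : ℕ}

/-- The family `a` of `n`-tuples satisfies `χ`, with parameters `c`, along all injective
`k`-subfamilies. -/
def HomogeneousOn (χ : L.Formula (Fin p × Fin n ⊕ Fin k × Fin n)) (c : Fin p × Fin n → M)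
    {I : Type*} (a : I → Fin n → M) : Prop :=
  ∀ e : Fin k ↪ I, χ.Realize (Sum.elim c fun q => a (e q.1) q.2)

theorem HomogeneousOn.map {χ : L.Formula (Fin p × Fin n ⊕ Fin k × Fin n)} {c : Fin p × Fin n → M}
    {I : Type*} {a : I → Fin n → M} (h : HomogeneousOn χ c a) (f : M ↪ₑ[L] N) :
    HomogeneousOn χ (f ∘ c) (fun i => f ∘ a i) := by
  intro e
  have := (f.map_formula χ _).2 (h e)
  rwa [Sum.comp_elim] at this

/-- The formula expressing that there is a homogeneous family of length `ℓ`. -/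
noncomputable def homogeneousFormula (χ : L.Formula (Fin p × Fin n ⊕ Fin k × Fin n)) (ℓ : ℕ) :
    L.Formula (Fin p × Fin n) :=
  Formula.iExs (Fin ℓ × Fin n) (Formula.iInf fun e : Fin k ↪ Fin ℓ =>
    χ.relabel (Sum.map id (fun q => (e q.1, q.2))))

theorem realize_homogeneousFormula {χ : L.Formula (Fin p × Fin n ⊕ Fin k × Fin n)} {ℓ : ℕ}
    {c : Fin p × Fin n → M} :
    (homogeneousFormula χ ℓ).Realize c ↔ ∃ a : Fin ℓ → Fin n → M, HomogeneousOn χ c a := by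
  have h : ∀ (a : Fin ℓ × Fin n → M) (e : Fin k ↪ Fin ℓ),
      Sum.elim c a ∘ Sum.map id (fun q : Fin k × Fin n => (e q.1, q.2)) =
        Sum.elim c fun q => a (e q.1, q.2) := fun a e => by
    ext q
    rcases q with q | q <;> rfl
  simp only [homogeneousFormula, Formula.realize_iExs, Formula.realize_iInf,
    Formula.realize_relabel, HomogeneousOn, h]
  exact ⟨fun ⟨a, ha⟩ => ⟨fun i j => a (i, j), ha⟩, fun ⟨a, ha⟩ => ⟨fun q => a q.1 q.2, ha⟩⟩

/-- Having a family of a fixed finite length is one formula in the parameters, so patterns over old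
parameters gain no new finite lengths later in a chain. -/
theorem ElementaryEmbedding.exists_homogeneousOn_iff (f : M ↪ₑ[L] N)
    (χ : L.Formula (Fin p × Fin n ⊕ Fin k × Fin n)) (c : Fin p × Fin n → M) (ℓ : ℕ) :
    (∃ a : Fin ℓ → Fin n → N, HomogeneousOn χ (f ∘ c) a) ↔
      ∃ a : Fin ℓ → Fin n → M, HomogeneousOn χ c a := by
  rw [← realize_homogeneousFormula, f.map_formula, realize_homogeneousFormula]

/-- `M` contains `J`-indexed homogeneous families for all patterns that have arbitrarily long finite
homogeneous families. -/
def HasHomogeneousFamilies (L : Language.{u, v}) (M : Type w) [L.Structure M] (J : Type*) : Prop :=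
  ∀ (n p k : ℕ) (χ : L.Formula (Fin p × Fin n ⊕ Fin k × Fin n)) (c : Fin p × Fin n → M),
    (∀ ℓ, ∃ a : Fin ℓ → Fin n → M, HomogeneousOn χ c a) →
      ∃ a : J → Fin n → M, HomogeneousOn χ c a

end Homogeneous

/-- Compactness for the elementary diagram of `M` plus `Γ`, cut back to the size of `M` so that the
extension can be iterated without growth. -/
theorem exists_elementaryEmbedding_realize {L : Language.{u, v}} (M : Type w) [L.Structure M]
    [Infinite M] {X : Type x} {G : Type y} (Γ : G → L.Formula (M ⊕ X))
    (hΓ : ∀ s : Finset G, ∃ a : X → M, ∀ g ∈ s, (Γ g).Realize (Sum.elim id a))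
    (hL : Cardinal.lift.{w} L.card ≤ Cardinal.lift.{max u v} #M)
    (hX : Cardinal.lift.{w} #X ≤ Cardinal.lift.{x} #M) :
    ∃ (N : Bundled.{w} L.Structure) (f : M ↪ₑ[L] N) (a : X → N), #N = #M ∧
      ∀ g, (Γ g).Realize (Sum.elim f a) := by
  classical
  let D := {φ : L.Formula M // φ.Realize id}
  have : Nonempty D := ⟨⟨⊤, by simp⟩⟩
  obtain ⟨N, b, hb⟩ := Theory.exists_model_realize (∅ : L.Theory) (X := M ⊕ X) (G := D ⊕ G)
    (Sum.elim (fun φ => φ.1.relabel Sum.inl) Γ) (by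
      intro s
      obtain ⟨a, ha⟩ := hΓ s.toRight
      refine ⟨Theory.ModelType.of ∅ M, Sum.elim id a, ?_⟩
      rintro (φ | g) hg
      · exact Formula.realize_relabel.2 φ.2
      · exact ha g (by simpa using hg))
  have hbD : ∀ φ : L.Formula M, φ.Realize (b ∘ Sum.inl) ↔ φ.Realize id := by
    intro φ
    by_cases hφ : φ.Realize id
    · have := hb (Sum.inl ⟨φ, hφ⟩)
      simp only [Sum.elim_inl, Formula.realize_relabel] at this
      simp [hφ, this]
    · have := hb (Sum.inl ⟨φ.not, hφ⟩)
      simp only [Sum.elim_inl, Formula.realize_relabel, Formula.realize_not] at this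
      simp [hφ, this]
  have hinj : Function.Injective (b ∘ Sum.inl) := by
    intro m m' h
    have := (hbD ((Term.var m).equal (Term.var m'))).1 (by simpa using h)
    simpa using this
  have : Infinite N := Infinite.of_injective _ hinj
  have hM : ℵ₀ ≤ #M := aleph0_le_mk M
  obtain ⟨N', b', hN', hb'⟩ := exists_card_eq_realize_iff N b #M hM hL (by
    rw [mk_sum, lift_add]
    refine Cardinal.add_le_of_le (aleph0_le_lift.2 hM) ?_ ?_
    · simp
    · have := Cardinal.lift_le.{w}.2 hX
      simpa [Cardinal.lift_lift] using this)
  refine ⟨N', ⟨b' ∘ Sum.inl, fun n φ a => ?_⟩, b' ∘ Sum.inr, hN', fun g => ?_⟩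
  · have h1 := hb' ((φ.relabel a).relabel Sum.inl)
    have h2 := hbD (φ.relabel a)
    simp only [Formula.realize_relabel] at h1 h2
    exact h1.trans h2
  · have := (hb' (Γ g)).2 (hb (Sum.inr g))
    convert this using 1
    exact Sum.elim_comp_inl_inr b'

theorem mk_arrow_le_of_finite {α : Type} [Finite α] {M : Type w} (h : ℵ₀ ≤ #M) :
    #(α → M) ≤ #M := by
  have := Fintype.ofFinite α
  rw [mk_arrow, lift_uzero, mk_fintype α, lift_natCast]
  exact power_nat_le h

theorem exists_extension_homogeneous {L : Language.{u, v}} (M : Type w) [L.Structure M]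
    [Infinite M] (hL : Cardinal.lift.{w} L.card ≤ Cardinal.lift.{max u v} #M) (J : Type w)
    (hJ : #J = #M) :
    ∃ (N : Bundled.{w} L.Structure) (f : M ↪ₑ[L] N), #N = #M ∧
      ∀ (n p k : ℕ) (χ : L.Formula (Fin p × Fin n ⊕ Fin k × Fin n)) (c : Fin p × Fin n → M),
        (∀ ℓ, ∃ a : Fin ℓ → Fin n → M, HomogeneousOn χ c a) →
          ∃ a : J → Fin n → N, HomogeneousOn χ (f ∘ c) a := by
  classical
  let I := Σ q : ℕ × ℕ × ℕ, {t : L.Formula (Fin q.2.1 × Fin q.1 ⊕ Fin q.2.2 × Fin q.1) ×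
    (Fin q.2.1 × Fin q.1 → M) // ∀ ℓ, ∃ a : Fin ℓ → Fin q.1 → M, HomogeneousOn t.1 t.2 a}
  let X := Σ i : I, J × Fin i.1.1
  let G := Σ i : I, (Fin i.1.2.2 ↪ J)
  have hM : ℵ₀ ≤ Cardinal.lift.{max u v} #M := aleph0_le_lift.2 (aleph0_le_mk M)
  have hI : #I ≤ Cardinal.lift.{max u v} #M := by
    rw [mk_sigma]
    refine (Cardinal.sum_le_sum _ (fun _ => Cardinal.lift.{max u v} #M) fun q => ?_).trans ?_
    · refine (mk_subtype_le _).trans ?_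
      rw [mk_prod]
      refine Cardinal.mul_le_of_le hM ?_ ?_
      · have h1 : #(L.Formula (Fin q.2.1 × Fin q.1 ⊕ Fin q.2.2 × Fin q.1)) ≤ max ℵ₀ L.card := by
          refine (mk_le_of_injective (f := fun φ => (⟨0, φ⟩ : Σ n, L.BoundedFormula _ n))
            sigma_mk_injective).trans (BoundedFormula.card_le.trans ?_)
          refine max_le (le_max_left _ _) (Cardinal.add_le_of_le (le_max_left _ _) ?_ ?_)
          · exact (lift_le_aleph0.2 (mk_le_aleph0)).trans (le_max_left _ _)
          · simp
        have h2 := Cardinal.lift_le.{w}.2 h1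
        rw [lift_max, lift_aleph0] at h2
        exact h2.trans (max_le hM hL)
      · refine Cardinal.lift_le.2 ?_
        exact mk_arrow_le_of_finite (aleph0_le_mk M)
    · rw [sum_const]
      refine Cardinal.mul_le_of_le (by simp) ?_ (by simp)
      exact (lift_le_aleph0.2 (mk_le_aleph0)).trans (by simp)
  have hX : Cardinal.lift.{w} #X ≤ Cardinal.lift.{max u v w} #M := by
    have : #X ≤ Cardinal.lift.{max u v} #M := by
      rw [mk_sigma]
      refine (Cardinal.sum_le_sum _ (fun _ => #M) fun i => ?_).trans ?_
      · rw [mk_prod]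
        refine Cardinal.mul_le_of_le (aleph0_le_mk M) (by simp [hJ]) ?_
        exact (lift_le_aleph0.2 mk_le_aleph0).trans (aleph0_le_mk M)
      · rw [sum_const]
        refine Cardinal.mul_le_of_le hM ?_ ?_
        · rwa [Cardinal.lift_id'.{w, max u v}]
        · rw [Cardinal.lift_umax.{w, max u v}]
    simpa [Cardinal.lift_lift, Cardinal.lift_umax] using Cardinal.lift_le.{w}.2 this
  obtain ⟨N, f, a, hN, ha⟩ := exists_elementaryEmbedding_realize M (X := X) (G := G)
    (fun g => g.1.2.1.1.relabel (Sum.map g.1.2.1.2 fun q => ⟨g.1, g.2 q.1, q.2⟩)) (by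
      intro s
      -- Finitely many instances mention only the finite index set `J₀`, so a family of length
      -- `J₀.card` for each pattern suffices; values off `J₀` are immaterial.
      let J₀ : Finset J := s.biUnion fun g => Finset.univ.map g.2
      have hmem : ∀ g ∈ s, ∀ r, g.2 r ∈ J₀ := fun g hg r =>
        Finset.mem_biUnion.2 ⟨g, hg, Finset.mem_map_of_mem _ (Finset.mem_univ r)⟩
      have : Nonempty M := inferInstance
      choose b hb using fun i : I => i.2.2 J₀.card
      refine ⟨fun x => if h : x.2.1 ∈ J₀ then b x.1 (J₀.equivFin ⟨x.2.1, h⟩) x.2.2 else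
        Classical.arbitrary M, fun g hg => ?_⟩
      rw [Formula.realize_relabel]
      have := hb g.1 ⟨fun r => J₀.equivFin ⟨g.2 r, hmem g hg r⟩, fun r r' h => by
        simpa using h⟩
      convert this using 1
      ext q
      rcases q with q | q
      · rfl
      · simp only [Function.comp_apply, Sum.map_inr, Sum.elim_inr, hmem g hg, dite_true]
        rfl) hL hX
  refine ⟨N, f, hN, fun n p k χ c hc => ?_⟩
  let i : I := ⟨(n, p, k), (χ, c), hc⟩
  refine ⟨fun j q => a ⟨i, j, q⟩, fun e => ?_⟩
  have := ha ⟨i, e⟩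
  rw [Formula.realize_relabel] at this
  convert this using 1
  ext q
  rcases q with q | q <;> rfl

/-- Tarski's elementary chain theorem. At a quantifier, an element of the limit is moved to a stage
`k` above `i`, where elementarity of the map from `G i` to `G k` applies. -/
theorem DirectLimit.realize_of {L : Language.{u, v}} {ι : Type x} [Preorder ι]
    [IsDirectedOrder ι] [Nonempty ι] {G : ι → Type w} [∀ i, L.Structure (G i)]
    (f : ∀ i j, i ≤ j → G i ↪[L] G j) [DirectedSystem G fun i j h => f i j h]
    (hf : ∀ i j h, ∃ g : G i ↪ₑ[L] G j, ⇑g = f i j h) {α : Type y} {n : ℕ}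
    (φ : L.BoundedFormula α n) (i : ι) (v : α → G i) (xs : Fin n → G i) :
    φ.Realize (of L ι G f i ∘ v) (of L ι G f i ∘ xs) ↔ φ.Realize v xs := by
  induction φ generalizing i with
  | falsum => rfl
  | equal t₁ t₂ =>
    exact (BoundedFormula.IsAtomic.equal t₁ t₂).isQF.realize_embedding (of L ι G f i)
  | rel R ts =>
    exact (BoundedFormula.IsAtomic.rel R ts).isQF.realize_embedding (of L ι G f i)
  | imp φ ψ hφ hψ => simp only [BoundedFormula.realize_imp, hφ, hψ]
  | all φ ih =>
    simp only [BoundedFormula.realize_all]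
    refine ⟨fun h x => ?_, fun h z => ?_⟩
    · rw [← ih, Fin.comp_snoc]
      exact h _
    · obtain ⟨j, y, rfl⟩ := exists_of z
      obtain ⟨k, hik, hjk⟩ := directed_of (· ≤ ·) i j
      have hi : ⇑(of L ι G f i) = of L ι G f k ∘ f i k hik := funext fun b => of_f.symm
      rw [hi, Function.comp_assoc, Function.comp_assoc, ← of_f (hij := hjk), ← Fin.comp_snoc, ih]
      obtain ⟨g, hg⟩ := hf i k hik
      have := (g.map_boundedFormula φ.all v xs).2 h
      rw [hg] at this
      exact this _

/-- Every consistent theory with infinite models has, in each large enough cardinality, a model with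
homogeneous families of the size of the model. -/
theorem Theory.exists_model_hasHomogeneousFamilies {L : Language.{u, v}} (T : L.Theory)
    (hT : ∃ M : T.ModelType.{u, v, max u v}, Infinite M) (J : Type w) [Infinite J]
    (hL : Cardinal.lift.{w} L.card ≤ Cardinal.lift.{max u v} #J) :
    ∃ M : T.ModelType.{u, v, w}, #M = #J ∧ L.HasHomogeneousFamilies M J := by
  obtain ⟨M₀, hM₀⟩ := Theory.exists_model_card_eq hT #J (aleph0_le_mk J) hL
  have step : ∀ M : {M : Bundled.{w} L.Structure // #M = #J},
      ∃ (N : {M : Bundled.{w} L.Structure // #M = #J}) (f : M.1 ↪ₑ[L] N.1),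
      ∀ (n p k : ℕ) (χ : L.Formula (Fin p × Fin n ⊕ Fin k × Fin n)) (c : Fin p × Fin n → M.1),
        (∀ ℓ, ∃ a : Fin ℓ → Fin n → M.1, HomogeneousOn χ c a) →
          ∃ a : J → Fin n → N.1, HomogeneousOn χ (f ∘ c) a := by
    rintro ⟨M, hM⟩
    have : Infinite M := infinite_iff.2 (hM ▸ aleph0_le_mk J)
    obtain ⟨N, f, hN, hf⟩ := exists_extension_homogeneous (L := L) M (hM ▸ hL) J hM.symm
    exact ⟨⟨N, hN.trans hM⟩, f, hf⟩
  choose next emb hemb using step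
  let G : ℕ → {M : Bundled.{w} L.Structure // #M = #J} := fun i =>
    Nat.rec ⟨⟨M₀, inferInstance⟩, hM₀⟩ (fun _ M => next M) i
  let F : ∀ i j, i ≤ j → (G i).1 ↪[L] (G j).1 :=
    DirectedSystem.natLERec (G' := fun i => (G i).1) fun i => (emb (G i)).toEmbedding
  have : DirectedSystem (fun i => ((G i).1 : Type w)) fun i j h => F i j h :=
    DirectedSystem.natLERec.directedSystem _
  have hsucc : ∀ i y, F i (i + 1) i.le_succ y = emb (G i) y := fun i y => by
    simp only [F, DirectedSystem.coe_natLERec]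
    exact Nat.leRecOn_succ' _
  have hF : ∀ i j h, ∃ g : (G i).1 ↪ₑ[L] (G j).1, ⇑g = F i j h := by
    intro i j h
    induction j, h using Nat.le_induction with
    | base =>
      refine ⟨ElementaryEmbedding.refl L _, ?_⟩
      ext x
      exact (DirectedSystem.map_self (fun i j h => F i j h) x).symm
    | succ j h ih =>
      obtain ⟨g, hg⟩ := ih
      refine ⟨(emb (G j)).comp g, ?_⟩
      ext x
      have h1 : F i (j + 1) (h.trans j.le_succ) x = F j (j + 1) j.le_succ (F i j h x) :=
        (DirectedSystem.map_map (fun i j h => F i j h) _ _ x).symm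
      rw [h1, hsucc, ← hg]
      rfl
  let N := DirectLimit (fun i => ((G i).1 : Type w)) F
  let o : ∀ i, (G i).1 ↪ₑ[L] N := fun i =>
    ⟨DirectLimit.of L ℕ (fun i => ((G i).1 : Type w)) F i, fun n φ x => by
      have := DirectLimit.realize_of F hF φ i x default
      rwa [Subsingleton.elim (_ ∘ default) default] at this⟩
  have ho : ∀ i x, o (i + 1) (emb (G i) x) = o i x := fun i x => by
    rw [← hsucc]
    exact DirectLimit.of_f
  have : Nonempty N := ⟨o 0 (Classical.arbitrary M₀)⟩
  have hmod : N ⊨ T := ((o 0).theory_model_iff T).1 M₀.is_model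
  refine ⟨Theory.ModelType.of T N, ?_, fun n p k χ c hc => ?_⟩
  · apply le_antisymm
    · have hsurj : Function.Surjective fun z : Σ i, (G i).1 => o z.1 z.2 := fun z => by
        obtain ⟨i, y, hy⟩ := DirectLimit.exists_of z
        exact ⟨⟨i, y⟩, hy⟩
      refine (mk_le_of_surjective hsurj).trans ?_
      rw [mk_sigma]
      refine (Cardinal.sum_le_sum _ (fun _ => #J) fun i => (G i).2.le).trans ?_
      rw [sum_const]
      simp
    · exact hM₀.symm.le.trans (mk_le_of_injective (o 0).injective)
  -- The finite tuple `c` lies in some stage; its finite families descend there by elementarity, and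
  -- the next stage supplies the large one.
  · obtain ⟨i, c, rfl⟩ : ∃ (i : ℕ) (c' : Fin p × Fin n → (G i).1), c = o i ∘ c' :=
      DirectLimit.exists_quotient_mk'_sigma_mk'_eq _ _ c
    obtain ⟨a, ha⟩ := hemb (G i) n p k χ c fun ℓ => ((o i).exists_homogeneousOn_iff χ c ℓ).1 (hc ℓ)
    refine ⟨fun j => o (i + 1) ∘ a j, ?_⟩
    have hc' : o i ∘ c = o (i + 1) ∘ emb (G i) ∘ c := funext fun q => (ho i _).symm
    rw [hc']
    exact HomogeneousOn.map ha (o (i + 1))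

end Language

end FirstOrder

/-! ### From homogeneous families to limits of ultrafilters. -/

/-- Because the exceptional sets are finite, their union has size at most `#I * ℵ₀`; hence `#J` may
be singular. -/
theorem Cardinal.exists_notMem_iUnion_of_finite {I J : Type w} [Infinite J] (h : #I < #J)
    (E : I → Set J) (hE : ∀ i, (E i).Finite) : ∃ j, j ∉ ⋃ i, E i := by
  by_contra! hcon
  have huniv : ⋃ i, E i = Set.univ := Set.eq_univ_of_forall hcon
  rcases finite_or_infinite I with hI | hI
  · exact Set.infinite_univ (huniv ▸ Set.finite_iUnion hE)
  · have h1 : #J ≤ #I * ℵ₀ := by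
      rw [← mk_univ, ← huniv]
      refine (mk_iUnion_le_sum_mk).trans ((Cardinal.sum_le_sum _ (fun _ => ℵ₀) fun i => ?_).trans ?_)
      · exact (hE i).countable.le_aleph0
      · simp
    rw [mul_aleph0_eq (aleph0_le_mk I)] at h1
    exact h1.not_gt h

namespace FirstOrder

namespace Language

theorem Formula.realize_congr_of_freeVarFinset {L : Language.{u, v}} {α : Type x} [DecidableEq α]
    {M : Type w} [L.Structure M] (φ : L.Formula α) {v v' : α → M}
    (h : ∀ a ∈ φ.freeVarFinset, v a = v' a) : φ.Realize v ↔ φ.Realize v' :=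
  (BoundedFormula.realize_restrictFreeVar (φ := φ) (f := id) (v := fun a => v a) v
    fun _ => rfl).symm.trans
  (BoundedFormula.realize_restrictFreeVar (φ := φ) (f := id) (v := fun a => v a) v'
    fun a => h a a.2)

section

variable {L : Language.{u, v}} {ι : Type x} [Finite ι] {n N : ℕ}

/-- The formula expressing that for every `ψ i`-instance some member of the `K`-tuple `x` of
`n`-tuples agrees with the majority among `2 * K` parameters. -/
noncomputable def majorityFormula (ψ : ι → L.Formula (Fin n ⊕ Fin N)) (K : ℕ) :
    L.Formula (Fin (2 * K) × Fin n ⊕ Fin K × Fin n) :=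
  Formula.iInf fun i => Formula.iAlls (Fin N) (Formula.iSup fun s : Fin K =>
    ((ψ i).relabel (Sum.map (fun q => Sum.inr (s, q)) id)).iff
      (Formula.iSup fun e : Fin K ↪ Fin (2 * K) => Formula.iInf fun r : Fin K =>
        (ψ i).relabel (Sum.map (fun q => Sum.inl (e r, q)) id)))

theorem realize_majorityFormula {M : Type w} [L.Structure M] (ψ : ι → L.Formula (Fin n ⊕ Fin N))
    (K : ℕ) (c : Fin (2 * K) → Fin n → M) (a : Fin K → Fin n → M) :
    (majorityFormula ψ K).Realize (Sum.elim (fun q => c q.1 q.2) fun q => a q.1 q.2) ↔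
      ∀ i y, ∃ s, (ψ i).Realize (Sum.elim (a s) y) ↔
        ∃ e : Fin K ↪ Fin (2 * K), ∀ r, (ψ i).Realize (Sum.elim (c (e r)) y) := by
  have h1 : ∀ (y : Fin N → M) (s : Fin K),
      Sum.elim (Sum.elim (fun q : Fin (2 * K) × Fin n => c q.1 q.2)
        fun q : Fin K × Fin n => a q.1 q.2) y ∘
        Sum.map (fun q => Sum.inr (s, q)) id = Sum.elim (a s) y := fun y s => by
    ext q
    rcases q with q | q <;> rfl
  have h2 : ∀ (y : Fin N → M) (s : Fin (2 * K)),
      Sum.elim (Sum.elim (fun q : Fin (2 * K) × Fin n => c q.1 q.2)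
        fun q : Fin K × Fin n => a q.1 q.2) y ∘
        Sum.map (fun q => Sum.inl (s, q)) id = Sum.elim (c s) y := fun y s => by
    ext q
    rcases q with q | q <;> rfl
  simp only [majorityFormula, Formula.realize_iInf, Formula.realize_iAlls, Formula.realize_iSup,
    Formula.realize_iff, Formula.realize_relabel, h1, h2]

theorem Theory.IsStable.exists_uniform_order_bound {T : L.Theory} (hT : T.IsStable)
    (ψ : ι → L.Formula (Fin n ⊕ Fin N)) :
    ∃ K : ℕ, ∀ (M : Theory.ModelType.{u, v, w} T) i, ¬ ∃ (a : Fin K → Fin n → M)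
      (b : Fin K → Fin N → M), ∀ s t, (ψ i).Realize (Sum.elim (a s) (b t)) ↔ s < t := by
  have := Fintype.ofFinite ι
  choose K hK using fun i => hT.exists_order_bound.{u, v, w} (ψ i)
  refine ⟨Finset.univ.sup K, fun M i ⟨a, b, hab⟩ => hK i M ?_⟩
  have hi : K i ≤ Finset.univ.sup K := Finset.le_sup (Finset.mem_univ i)
  exact ⟨a ∘ Fin.castLE hi, b ∘ Fin.castLE hi, fun s t => by simp [hab]⟩

/-- In a model of a stable theory with large homogeneous families, finitely many local types given by
an ultrafilter on tuples are limits of large families of tuples. -/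
theorem Theory.IsStable.exists_family_finite_exceptions {T : L.Theory} (hT : T.IsStable)
    (M : Theory.ModelType.{u, v, w} T) {J : Type y} (hJ : L.HasHomogeneousFamilies M J)
    (ψ : ι → L.Formula (Fin n ⊕ Fin N)) (U : Ultrafilter (Fin n → M)) :
    ∃ a : J → Fin n → M, ∀ i (y : Fin N → M), {j | ¬ ((ψ i).Realize (Sum.elim (a j) y) ↔
      ∀ᶠ x in U, (ψ i).Realize (Sum.elim x y))}.Finite := by
  -- Negations are included because exceptions must be bounded both where the limit is true and
  -- where it is false.
  obtain ⟨K, hK⟩ := hT.exists_uniform_order_bound.{u, v, w}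
    (fun q : ι × Bool => if q.2 then ψ q.1 else (ψ q.1).not)
  obtain ⟨a, ha⟩ := U.exists_seq_few_exceptions
    (fun i x (y : Fin N → M) => (ψ i).Realize (Sum.elim x y)) K
    (fun i => by simpa using hK M (i, true)) (fun i => by simpa using hK M (i, false))
  have hmaj : ∀ i (y : Fin N → M), (∃ e : Fin K ↪ Fin (2 * K), ∀ r,
      (ψ i).Realize (Sum.elim (a (e r)) y)) ↔ ∀ᶠ x in U, (ψ i).Realize (Sum.elim x y) :=
    fun i y => exists_embedding_iff_of_few_exceptions
      (r := fun k : Fin (2 * K) => (ψ i).Realize (Sum.elim (a k) y))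
      fun e => ha i y (e.trans Fin.valEmbedding)
  -- The sequence `a` satisfies the pattern over its own first `2 * K` terms, so its initial
  -- segments are the required finite families.
  obtain ⟨b, hb⟩ := hJ n (2 * K) K (majorityFormula ψ K) (fun q => a q.1 q.2) fun ℓ =>
    ⟨fun j => a j, fun e => by
      refine (realize_majorityFormula ψ K (fun k => a k) (fun s => a (e s))).2 fun i y => ?_
      obtain ⟨s, hs⟩ := ha i y (e.trans Fin.valEmbedding)
      exact ⟨s, hs.trans (hmaj i y).symm⟩⟩
  refine ⟨b, fun i y => ?_⟩
  by_contra hinf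
  let f := Set.Infinite.natEmbedding _ hinf
  let e : Fin K ↪ J := (Fin.valEmbedding.trans f).trans (Function.Embedding.subtype _)
  obtain ⟨s, hs⟩ := (realize_majorityFormula ψ K (fun k => a k) (fun s => b (e s))).1 (hb e) i y
  exact (f s).2 (hs.trans (hmaj i y))

end

/-! ### Local saturation and its failure at the successor. -/

section LocalTypes

variable {L : Language.{u, v}} {M : Type w} [L.Structure M] {A : Set M} {n : ℕ}

theorem ConsistentSet.exists_ultrafilter {p : Set (L.Formula (Fin n ⊕ A))} (hp : ConsistentSet p) :
    ∃ U : Ultrafilter (Fin n → M), ∀ φ ∈ p,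
      ∀ᶠ b in U, φ.Realize (Sum.elim b (fun a : A => (a : M))) := by
  classical
  obtain ⟨U, hU⟩ := Ultrafilter.exists_ultrafilter_of_finite_inter_nonempty
    ((fun φ : L.Formula (Fin n ⊕ A) =>
      {b : Fin n → M | φ.Realize (Sum.elim b (fun a : A => (a : M)))}) '' p) (by
      intro t ht
      obtain ⟨q, hq, rfl⟩ := Finset.subset_set_image_iff.1 ht
      obtain ⟨b, hb⟩ := hp q hq
      exact ⟨b, by simpa [RealizesSet] using hb⟩)
  exact ⟨U, fun φ hφ => hU ⟨φ, hφ, rfl⟩⟩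

/-- Truth along an ultrafilter commutes with `⊥` and `imp`, so only the finitely many formulas of
`Δ` need control. -/
theorem BooleanSpan.realize_iff_eventually {Δ : Set (L.Formula ℕ)} {σ : ℕ → Fin n ⊕ A}
    {U : Ultrafilter (Fin n → M)} {a : Fin n → M}
    (h : ∀ φ ∈ Δ, φ.Realize (Sum.elim a (fun a : A => (a : M)) ∘ σ) ↔
      ∀ᶠ x in U, φ.Realize (Sum.elim x (fun a : A => (a : M)) ∘ σ))
    {φ : L.Formula ℕ} (hφ : BooleanSpan Δ φ) :
    φ.Realize (Sum.elim a (fun a : A => (a : M)) ∘ σ) ↔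
      ∀ᶠ x in U, φ.Realize (Sum.elim x (fun a : A => (a : M)) ∘ σ) := by
  induction hφ with
  | of φ hφ => exact h φ hφ
  | bot => simp [Formula.realize_bot, U.neBot.ne]
  | imp φ ψ _ _ ih₁ ih₂ => simp only [Formula.realize_imp, Ultrafilter.eventually_imp, ih₁, ih₂]

theorem Theory.IsStable.isLocallySaturated {T : L.Theory} (hT : T.IsStable)
    (M : Theory.ModelType.{u, v, w} T) {J : Type w} [Infinite J]
    (hJ : L.HasHomogeneousFamilies M J) : L.IsLocallySaturated M #J := by
  classical
  intro A hA n p hp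
  obtain ⟨Δ, hΔ, hp⟩ := hp
  obtain ⟨U, hU⟩ := hp.prop.2.exists_ultrafilter
  obtain ⟨N, hN⟩ : ∃ N : ℕ, ∀ φ ∈ Δ, ∀ v ∈ φ.freeVarFinset, v < N + 1 := by
    refine ⟨hΔ.toFinset.sup fun φ => φ.freeVarFinset.sup id, fun φ hφ v hv => ?_⟩
    have h1 : v ≤ φ.freeVarFinset.sup id := Finset.le_sup (f := id) hv
    have h2 := Finset.le_sup (f := fun φ : L.Formula ℕ => φ.freeVarFinset.sup id)
      (hΔ.mem_toFinset.2 hφ)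
    exact Nat.lt_succ_of_le (h1.trans h2)
  have := hΔ.to_subtype
  -- A substitution is split into its shape `i.2`, telling type variables from parameter slots, and
  -- the parameters themselves. This leaves finitely many formulas.
  obtain ⟨a, ha⟩ := hT.exists_family_finite_exceptions M hJ
    (ι := Δ × (Fin (N + 1) → Fin n ⊕ Fin (N + 1)))
    (fun i => i.1.1.relabel (i.2 ∘ Fin.ofNat (N + 1))) U
  obtain ⟨m₀⟩ : Nonempty M := inferInstance
  -- `none` marks a slot whose variable became a type variable; its value `m₀` is never read.
  let par : (Fin (N + 1) → Option A) → Fin (N + 1) → M := fun b v => (b v).elim m₀ (↑)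
  have hcard : #(Fin (N + 1) → Option A) < #J := by
    rcases finite_or_infinite A with hfin | hinf
    · exact (lt_aleph0_of_finite _).trans_le (aleph0_le_mk J)
    · refine (mk_arrow_le_of_finite (aleph0_le_mk _)).trans_lt ?_
      rw [mk_option, add_one_eq (aleph0_le_mk A)]
      exact hA
  obtain ⟨j, hj⟩ := Cardinal.exists_notMem_iUnion_of_finite hcard _
    (fun b => Set.finite_iUnion fun i => ha i (par b))
  simp only [Set.mem_iUnion, not_exists, Set.mem_ofPred_eq, not_not] at hj
  have key : ∀ (σ : ℕ → Fin n ⊕ A), ∀ φ ∈ Δ,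
      φ.Realize (Sum.elim (a j) (fun a : A => (a : M)) ∘ σ) ↔
        ∀ᶠ x in U, φ.Realize (Sum.elim x (fun a : A => (a : M)) ∘ σ) := by
    intro σ φ hφ
    let τ : Fin (N + 1) → Fin n ⊕ Fin (N + 1) := fun v => Sum.map id (fun _ => v) (σ v)
    let b : Fin (N + 1) → Option A := fun v => (σ v).getRight?
    have hσ : ∀ x : Fin n → M, (φ.relabel (τ ∘ Fin.ofNat (N + 1))).Realize (Sum.elim x (par b)) ↔
        φ.Realize (Sum.elim x (fun a : A => (a : M)) ∘ σ) := by
      intro x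
      rw [Formula.realize_relabel]
      refine φ.realize_congr_of_freeVarFinset fun v hv => ?_
      have hv' : ((Fin.ofNat (N + 1) v : Fin (N + 1)) : ℕ) = v := Nat.mod_eq_of_lt (hN φ hφ v hv)
      simp only [Function.comp_apply, τ, hv']
      rcases h : σ v with q | q
      · rfl
      · simp only [par, b, hv', h, Sum.map_inr, Sum.elim_inr, Sum.getRight?_inr, Option.elim_some]
    have := hj b (⟨φ, hφ⟩, τ)
    simpa only [hσ] using this
  refine ⟨a j, fun χ hχ => ?_⟩
  obtain ⟨φ, hφ, σ, rfl⟩ := hp.prop.1 hχ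
  have := hU _ hχ
  simp only [Formula.realize_relabel] at this ⊢
  exact (hφ.realize_iff_eventually (key σ)).2 this

/-- The formulas in `L_{x,Δ}(A)` holding along an ultrafilter form a `Δ`-type. -/
theorem isDeltaType_of_ultrafilter (Δ : Set (L.Formula ℕ)) (U : Ultrafilter (Fin n → M)) :
    IsDeltaType Δ {χ ∈ deltaFormulas Δ A n |
      ∀ᶠ b in U, χ.Realize (Sum.elim b (fun a : A => (a : M)))} := by
  classical
  refine ⟨⟨fun _ h => h.1, fun q hq => ?_⟩, fun q hq hle χ hχ => ⟨hq.1 hχ, ?_⟩⟩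
  · have : ∀ᶠ b in U, ∀ χ ∈ q, χ.Realize (Sum.elim b (fun a : A => (a : M))) :=
      (Finset.eventually_all q).2 fun χ hχ => (hq hχ).2
    exact this.exists
  · by_contra hcon
    obtain ⟨φ, hφ, σ, rfl⟩ := hq.1 hχ
    have hnot : (φ.imp ⊥).relabel σ ∈ q := by
      refine hle ⟨⟨_, .imp _ _ hφ .bot, σ, rfl⟩, ?_⟩
      refine (Ultrafilter.eventually_not.2 hcon).mono fun b hb => ?_
      rw [Formula.realize_relabel] at hb ⊢
      exact hb
    obtain ⟨b, hb⟩ := hq.2 {φ.relabel σ, (φ.imp ⊥).relabel σ} (by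
      simp only [Finset.coe_insert, Finset.coe_singleton]
      exact Set.insert_subset hχ (Set.singleton_subset_iff.2 hnot))
    have h1 := hb (φ.relabel σ) (by simp)
    have h2 := hb ((φ.imp ⊥).relabel σ) (by simp)
    rw [Formula.realize_relabel] at h1 h2
    exact h2 h1

/-- Along a nonprincipal ultrafilter `v₀ = v₁` fails for every parameter, so the resulting type over
all of `M` excludes each element. -/
theorem not_isLocallySaturated_succ (L : Language.{u, v}) (M : Type w) [L.Structure M]
    [Infinite M] : ¬ L.IsLocallySaturated M (Order.succ #M) := by
  intro h
  let Δ : Set (L.Formula ℕ) := {(Term.var 0).equal (Term.var 1)}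
  obtain ⟨b, hb⟩ := h Set.univ (by rw [mk_univ]; exact Order.lt_succ _) 1 _
    ⟨Δ, Set.finite_singleton _, isDeltaType_of_ultrafilter Δ (Filter.hyperfilter (Fin 1 → M))⟩
  let σ : ℕ → Fin 1 ⊕ (Set.univ : Set M) := fun i =>
    if i = 0 then Sum.inl 0 else Sum.inr ⟨b 0, trivial⟩
  have hχ : ∀ x : Fin 1 → M, ((((Term.var 0).equal (Term.var 1) : L.Formula ℕ).imp ⊥).relabel
      σ).Realize (Sum.elim x (fun a : (Set.univ : Set M) => (a : M))) ↔ x ≠ b := by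
    intro x
    rw [Formula.realize_relabel, Formula.realize_imp, Formula.realize_equal]
    simp [σ, Formula.realize_bot, funext_iff]
  refine (hχ b).1 (hb _ ⟨⟨_, .imp _ _ (.of _ rfl) .bot, σ, rfl⟩, ?_⟩) rfl
  simp only [hχ]
  exact Filter.hyperfilter_le_cofinite (Set.finite_singleton b).compl_mem_cofinite

end LocalTypes

/-! ### Passing to reducts, and the theorem. -/

theorem homogeneousOn_onFormula {L : Language.{u, v}} {L₁ : Language.{u₁, v₁}} {M : Type w}
    [L.Structure M] [L₁.Structure M] (ϕ : L →ᴸ L₁) [ϕ.IsExpansionOn M] {n p k : ℕ}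
    (χ : L.Formula (Fin p × Fin n ⊕ Fin k × Fin n)) (c : Fin p × Fin n → M) {I : Type*}
    (a : I → Fin n → M) : HomogeneousOn (ϕ.onFormula χ) c a ↔ HomogeneousOn χ c a := by
  simp only [HomogeneousOn, LHom.realize_onFormula]

theorem HasHomogeneousFamilies.of_isExpansionOn {L : Language.{u, v}} {L₁ : Language.{u₁, v₁}}
    {M : Type w} [L.Structure M] [L₁.Structure M] {J : Type*}
    (h : L₁.HasHomogeneousFamilies M J) (ϕ : L →ᴸ L₁) [ϕ.IsExpansionOn M] :
    L.HasHomogeneousFamilies M J := by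
  intro n p k χ c hc
  have := h n p k (ϕ.onFormula χ) c
  simp only [homogeneousOn_onFormula] at this
  exact this hc

end Language

end FirstOrder

theorem mainTheorem9 {L : FirstOrder.Language.{u, v}} (T : L.Theory) (hT : T.IsComplete)
    (hinf : ∃ M : T.ModelType.{u, v, max u v}, Infinite M) (hst : T.IsStable)
    (κ : Cardinal.{w}) (hκ : Cardinal.lift.{w} T.size ≤ Cardinal.lift.{max u v} κ) :
    FirstOrder.Language.Theory.HasLocalPCExactSaturation.{u, v, u₁, v₁, w} T κ := by
  intro L₁ ϕ hϕ T₁ hT₁ hsub hcard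
  have hκ₀ : ℵ₀ ≤ κ := by
    have : Cardinal.lift.{w} ℵ₀ ≤ Cardinal.lift.{max u v} κ :=
      (Cardinal.lift_le.2 (self_le_add_left _ _)).trans hκ
    simpa using this
  have hL₁ : Cardinal.lift.{w} L₁.card ≤ Cardinal.lift.{max u₁ v₁} κ := by
    have h1 : Cardinal.lift.{w} T₁.size ≤ Cardinal.lift.{max u₁ v₁} κ := by
      rw [← Cardinal.lift_le.{max u v}]
      have h2 := congrArg Cardinal.lift.{w} hcard
      have h3 := Cardinal.lift_le.{max u₁ v₁}.2 hκ
      simp only [Cardinal.lift_lift] at h2 h3 ⊢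
      exact h2.le.trans h3
    exact (Cardinal.lift_le.2 (self_le_add_right _ _)).trans h1
  -- Completeness enters here: the reduct of a model of `T₁` is elementarily equivalent to an
  -- infinite model of `T`.
  have hinf₁ : ∃ M : T₁.ModelType.{u₁, v₁, max u₁ v₁}, Infinite M := by
    obtain ⟨M⟩ := hT₁
    obtain ⟨M', hM'⟩ := hinf
    let _ := ϕ.reduct M
    have : ϕ.IsExpansionOn M := FirstOrder.Language.LHom.isExpansionOn_reduct _ _
    have : M ⊨ T := (FirstOrder.Language.LHom.onTheory_model ϕ T).1 (M.is_model.mono hsub)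
    have hequiv : FirstOrder.Language.ElementarilyEquivalent L M' M := hT.models_elementarily_equivalent M' M
    exact ⟨M, hequiv.infinite_iff.1 hM'⟩
  have hout : #κ.out = κ := mk_out κ
  have : Infinite κ.out := infinite_iff.2 (hout.symm ▸ hκ₀)
  -- The chain is built in `L₁`, so its union is a model of `T₁`; stability is then applied only to
  -- the `L`-reduct.
  obtain ⟨M, hM, hhom⟩ := T₁.exists_model_hasHomogeneousFamilies hinf₁ κ.out (hout.symm ▸ hL₁)
  let _ := ϕ.reduct M
  have hexp : ϕ.IsExpansionOn M := FirstOrder.Language.LHom.isExpansionOn_reduct _ _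
  have : M ⊨ T := (FirstOrder.Language.LHom.onTheory_model ϕ T).1 (M.is_model.mono hsub)
  have hhom' : L.HasHomogeneousFamilies M κ.out := hhom.of_isExpansionOn ϕ
  have : Infinite M := infinite_iff.2 (by rw [hM, hout]; exact hκ₀)
  refine ⟨FirstOrder.Language.Theory.ModelType.of T M, ⟨M.struc, hexp, M.is_model⟩, ?_, ?_⟩
  · rw [← hout]
    exact hst.isLocallySaturated (FirstOrder.Language.Theory.ModelType.of T M) hhom'
  · have h := FirstOrder.Language.not_isLocallySaturated_succ L M
    rwa [hM, hout] at h
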